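/- Let $\mathbb F_3=\langle a,b,c\rangle$ be the free group on three generators and let $S=\{a,b,c,a^{-1},b^{-1},c^{-1}\}$. For a subset $T$ of $\mathbb F_3$ that generates $\mathbb F_3$ as a monoid, let $|u|_T$ denote the least $m\ge 0$ such that $u$ is a product of $m$ elements of $T$ (the empty product being $1$). For $j\ge 2$ and $v\in\mathbb F_3$ put $$x(v,j)=v\,b^{5^{2j-1}}v^{-1}a^{5^{2j}}b^{5^{2j}},$$ and let $$X=S\cup\{x(v,j): j\ge 2,\ v\in\mathbb F_3,\ |v|_S\le 5^j\}.$$ **Proposition 3.8.** Let $r\ge 0$, $n_1,\dots,n_r\ge 2$ and $k_1,\dots,k_r\ge 0$ be integers with $$k_{i-1}>3\cdot 5^{2n_i}\qquad(i=2,\dots,r).$$ Then $$\bigl|a^{5^{2n_1}}b^{5^{2n_1}}c^{k_1}\cdots a^{5^{2n_r}}b^{5^{2n_r}}c^{k_r}\bigr|_X=\sum_{i=1}^r k_i+\sum_{i=1}^r\bigl(5^{2n_i-1}+1\bigr).$$ So the $X$-length is additive over these blocks: the left-hand side also equals $\sum_{i=1}^r\bigl|a^{5^{2n_i}}b^{5^{2n_i}}c^{k_i}\bigr|_X$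 and $\sum_{i=1}^r\bigl|a^{5^{2n_i}}b^{5^{2n_i}}\bigr|_X+\sum_{i=1}^r\bigl|c^{k_i}\bigr|_X$. -/

import Mathlib

namespace WordLen

/-- The `T`-word length of `g`: the least number of factors from `T` (inverses of elements of `T` are
not allowed unless they lie in `T`) in a product equal to `g`. The empty product is `1`.
If no product of elements of `T` equals `g`, the value is the junk value `0`; by
`closure_X` this does not happen for the generating set `X` below. -/
noncomputable def wordLength {G : Type*} [Group G] (T : Set G) (g : G) : ℕ :=
  sInf {m : ℕ | ∃ l : List G, l.length = m ∧ (∀ t ∈ l, t ∈ T) ∧ l.prod = g}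

/-- The free group on three generators. -/
abbrev F3 : Type := FreeGroup (Fin 3)

/-- The first free generator. -/
def a : F3 := FreeGroup.of 0

/-- The second free generator. -/
def b : F3 := FreeGroup.of 1

/-- The third free generator. -/
def c : F3 := FreeGroup.of 2

/-- The standard symmetric generating set. -/
def S : Set F3 := {a, b, c, a⁻¹, b⁻¹, c⁻¹}

/-- The element `x(v, j) = v b^(5^(2j-1)) v⁻¹ a^(5^(2j)) b^(5^(2j))`, used only for `j ≥ 2`. -/
def x (v : F3) (j : ℕ) : F3 :=
  v * b ^ 5 ^ (2 * j - 1) * v⁻¹ * a ^ 5 ^ (2 * j) * b ^ 5 ^ (2 * j)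

/-- The union over `j ≥ 2` of the sets `{x(v, j) : |v| ≤ 5^j}`, with `|v|` the `S`-word length. -/
def XInfty : Set F3 :=
  {u | ∃ j : ℕ, 2 ≤ j ∧ ∃ v : F3, wordLength S v ≤ 5 ^ j ∧ u = x v j}

/-- The infinite generating set. -/
def X : Set F3 := XInfty ∪ S

/-- `X` generates the free group as a monoid. -/
theorem closure_X : Submonoid.closure X = ⊤ := by
  have hS : ∀ i : Fin 3, FreeGroup.of i ∈ S ∧ (FreeGroup.of i)⁻¹ ∈ S := by
    intro i
    fin_cases i <;> simp [S, a, b, c]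
  rw [eq_top_iff]
  intro u _
  induction u using FreeGroup.induction_on with
  | C1 => exact one_mem _
  | of i => exact Submonoid.subset_closure (Or.inr (hS i).1)
  | inv_of i _ => exact Submonoid.subset_closure (Or.inr (hS i).2)
  | mul u v hu hv => exact mul_mem (hu trivial) (hv trivial)

end WordLen

namespace WordLen

open Finset

/-! The upper bound comes from `x 1 n`: after cancelling its leading power of `b` with `5 ^ (2n-1)`
letters `b⁻¹`, it gives the `a`- and `b`-powers of a block. For the lower bound, one exhibits a
function that vanishes at `1`, grows by at most 1 along every right multiplication by an element of
`X`, and takes the claimed value at the word. It is `P + expSum 2 - expSum 1`, where `P` is a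
potential on the Cayley tree that changes only along the `b`-edges of the word, by `weight n = 6/5 +
5 ^ (-2n)` on each edge of a block with parameter `n`. Such a block adds `6/5 * 5 ^ (2n) + 1` to
`P`.

The crux is `mul_x_le`: `x v j` raises `P` by at most `1 + 5 ^ (2j-1) + 5 ^ (2j) = weight j * 5 ^
(2j)`. If its final `b`-power meets a block with `n ≥ j`, then the conjugate `v b ^ _ v⁻¹` stays
away from all weighted edges (`mul_eq_of_isProdLE`), and the final segment gains at most `weight n *
5 ^ (2j)`. If `n < j`, that block is too short to matter. If no block is met, only the conjugate
contributes, and it is short. The large powers of `c` keep earlier blocks away. -/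

/-! ### Potentials on the Cayley tree of a free group -/

/-- A 1-cochain on the Cayley tree of a free group is the coboundary of a function. -/
theorem exists_potential {α A : Type*} [AddGroup A] (φ : FreeGroup α → α → A) :
    ∃ F : FreeGroup α → A, F 1 = 0 ∧ ∀ g i, F (g * FreeGroup.of i) = F g + φ g i := by
  -- Each generator acts on pairs (vertex, value) by crossing its edge and adding `φ`. Freeness
  -- extends this to an action, on the right, hence the opposite group.
  let E : α → Equiv.Perm (FreeGroup α × A) := fun i =>
    { toFun := fun p => (p.1 * FreeGroup.of i, p.2 + φ p.1 i)
      invFun := fun p => (p.1 * (FreeGroup.of i)⁻¹, p.2 - φ (p.1 * (FreeGroup.of i)⁻¹) i)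
      left_inv := fun p => by simp
      right_inv := fun p => by simp }
  let P : FreeGroup α →* (Equiv.Perm (FreeGroup α × A))ᵐᵒᵖ :=
    FreeGroup.lift fun i => MulOpposite.op (E i)
  have hP : ∀ i, P (FreeGroup.of i) = MulOpposite.op (E i) := fun i => by simp [P]
  have hfst : ∀ g q, ((P g).unop q).1 = q.1 * g := by
    intro g
    induction g using FreeGroup.induction_on with
    | C1 => simp
    | of i => intro q; rw [hP]; rfl
    | inv_of i _ => intro q; rw [map_inv, hP]; rfl
    | mul u v hu hv =>
      intro q
      rw [map_mul, MulOpposite.unop_mul, Equiv.Perm.mul_apply, hv, hu, mul_assoc]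
  refine ⟨fun g => ((P g).unop (1, 0)).2, by simp, fun g i => ?_⟩
  have h : ((P g).unop (1, 0)).1 = g := by rw [hfst]; simp
  simp only [map_mul, MulOpposite.unop_mul, Equiv.Perm.mul_apply, hP, MulOpposite.unop_op]
  change _ + φ ((P g).unop (1, 0)).1 i = _
  rw [h]

/-! ### Exponent sums -/

/-- The exponent sum of the `i`-th generator. -/
def expSum (i : Fin 3) (g : F3) : ℤ :=
  Multiplicative.toAdd
    (FreeGroup.lift (fun m : Fin 3 => Multiplicative.ofAdd (if m = i then (1 : ℤ) else 0)) g)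

@[simp] theorem expSum_one (i : Fin 3) : expSum i 1 = 0 := by simp [expSum]

@[simp] theorem expSum_mul (i : Fin 3) (g h : F3) :
    expSum i (g * h) = expSum i g + expSum i h := by simp [expSum]

@[simp] theorem expSum_inv (i : Fin 3) (g : F3) : expSum i g⁻¹ = -expSum i g := by simp [expSum]

@[simp] theorem expSum_pow (i : Fin 3) (g : F3) (m : ℕ) :
    expSum i (g ^ m) = m * expSum i g := by simp [expSum]

@[simp] theorem expSum_a (i : Fin 3) : expSum i a = if 0 = i then 1 else 0 := by simp [expSum, a]

@[simp] theorem expSum_b (i : Fin 3) : expSum i b = if 1 = i then 1 else 0 := by simp [expSum, b]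

@[simp] theorem expSum_c (i : Fin 3) : expSum i c = if 2 = i then 1 else 0 := by simp [expSum, c]

theorem abs_expSum_le_one (i : Fin 3) {t : F3} (ht : t ∈ S) : |expSum i t| ≤ 1 := by
  simp only [S, Set.mem_insert_iff, Set.mem_singleton_iff] at ht
  rcases ht with rfl | rfl | rfl | rfl | rfl | rfl <;> simp <;> split_ifs <;> simp

/-! ### Word length -/

/-- `g` is a product of at most `m` elements of `T`. -/
def IsProdLE {G : Type*} [Group G] (T : Set G) (m : ℕ) (g : G) : Prop :=
  ∃ l : List G, l.length ≤ m ∧ (∀ t ∈ l, t ∈ T) ∧ l.prod = g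

section IsProdLE

variable {G : Type*} [Group G] {T : Set G} {m m' : ℕ} {g h : G}

theorem IsProdLE.mul (hg : IsProdLE T m g) (hh : IsProdLE T m' h) :
    IsProdLE T (m + m') (g * h) := by
  obtain ⟨l, hl, hT, rfl⟩ := hg
  obtain ⟨l', hl', hT', rfl⟩ := hh
  refine ⟨l ++ l', by simp; omega, ?_, by simp⟩
  intro t ht
  exact (List.mem_append.1 ht).elim (hT t) (hT' t)

theorem IsProdLE.one : IsProdLE T 0 (1 : G) := ⟨[], by simp, by simp, by simp⟩

theorem IsProdLE.of_mem (hg : g ∈ T) : IsProdLE T 1 g :=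
  ⟨[g], by simp, by simpa using hg, by simp⟩

theorem IsProdLE.pow_of_mem (hg : g ∈ T) (m : ℕ) : IsProdLE T m (g ^ m) := by
  induction m with
  | zero => simpa using IsProdLE.one
  | succ m ih => rw [pow_succ]; exact ih.mul (.of_mem hg)

theorem IsProdLE.mono (hg : IsProdLE T m g) (h : m ≤ m') : IsProdLE T m' g := by
  obtain ⟨l, hl, hT⟩ := hg
  exact ⟨l, hl.trans h, hT⟩

theorem IsProdLE.inv (hT : ∀ t ∈ T, t⁻¹ ∈ T) (hg : IsProdLE T m g) : IsProdLE T m g⁻¹ := by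
  obtain ⟨l, hl, hlT, rfl⟩ := hg
  refine ⟨(l.map fun t => t⁻¹).reverse, by simpa using hl, ?_, by rw [List.prod_inv_reverse]⟩
  intro t ht
  simp only [List.mem_reverse, List.mem_map] at ht
  obtain ⟨s, hs, rfl⟩ := ht
  exact hT s (hlT s hs)

theorem wordLength_le (hg : IsProdLE T m g) : wordLength T g ≤ m := by
  obtain ⟨l, hl, hT, hp⟩ := hg
  have hmem : l.length ∈ {m : ℕ | ∃ l : List G, l.length = m ∧ (∀ t ∈ l, t ∈ T) ∧ l.prod = g} :=
    ⟨l, rfl, hT, hp⟩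
  exact (Nat.sInf_le hmem).trans hl

theorem isProdLE_wordLength (hT : Submonoid.closure T = ⊤) (g : G) :
    IsProdLE T (wordLength T g) g := by
  have hg : g ∈ Submonoid.closure T := hT ▸ Submonoid.mem_top g
  obtain ⟨l, hl, hp⟩ := Submonoid.exists_list_of_mem_closure hg
  have hne : {m : ℕ | ∃ l : List G, l.length = m ∧ (∀ t ∈ l, t ∈ T) ∧ l.prod = g}.Nonempty :=
    ⟨l.length, l, rfl, hl, hp⟩
  obtain ⟨l', h1, h2⟩ := Nat.sInf_mem hne
  exact ⟨l', h1.le, h2⟩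

/-- A function growing by at most `W` along each element of `T` grows by at most `W * m` along a
product of at most `m` elements. -/
theorem IsProdLE.apply_mul_le {F : G → ℚ} {W : ℚ} (hW : 0 ≤ W)
    (hF : ∀ g, ∀ t ∈ T, F (g * t) ≤ F g + W) (hh : IsProdLE T m h) (g : G) :
    F (g * h) ≤ F g + W * m := by
  obtain ⟨l, hl, hT, rfl⟩ := hh
  have key : ∀ (l : List G), (∀ t ∈ l, t ∈ T) → ∀ g, F (g * l.prod) ≤ F g + W * l.length := by
    intro l
    induction l with
    | nil => simp
    | cons t l ih =>
      intro hT g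
      rw [List.prod_cons, ← mul_assoc]
      have h1 := ih (fun s hs => hT s (List.mem_cons_of_mem _ hs)) (g * t)
      have h2 := hF g t (hT t List.mem_cons_self)
      push_cast [List.length_cons]
      linarith
  have h1 := key l hT g
  have h2 : W * l.length ≤ W * m := mul_le_mul_of_nonneg_left (by exact_mod_cast hl) hW
  linarith

/-- A function unchanged by steps from `T` inside a ball is constant on that ball. -/
theorem IsProdLE.apply_mul_eq {F : G → ℚ}
    (hF : ∀ u, ∀ t ∈ T, IsProdLE T m u → IsProdLE T m (u * t) → F (g * (u * t)) = F (g * u))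
    (hh : IsProdLE T m h) : F (g * h) = F g := by
  obtain ⟨l, hl, hT, rfl⟩ := hh
  induction l using List.reverseRecOn with
  | nil => simp
  | append_singleton l t ih =>
    have hl' : l.length ≤ m := by simp at hl; omega
    have hT' : ∀ s ∈ l, s ∈ T := fun s hs => hT s (by simp [hs])
    rw [← ih hl' hT']
    have := hF l.prod t (hT t (by simp)) ⟨l, hl', hT', rfl⟩ ⟨l ++ [t], hl, hT, by simp⟩
    simpa using this

/-- The source of all lower bounds. Only increments are controlled, because `X` is not closed under
inverses. -/
theorem le_wordLength (hT : Submonoid.closure T = ⊤) {F : G → ℚ} (h1 : F 1 = 0)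
    (hF : ∀ g, ∀ t ∈ T, F (g * t) ≤ F g + 1) (g : G) : F g ≤ wordLength T g := by
  have := (isProdLE_wordLength hT g).apply_mul_le zero_le_one hF 1
  simpa [h1] using this

end IsProdLE

theorem inv_mem_S {t : F3} (ht : t ∈ S) : t⁻¹ ∈ S := by
  simp only [S, Set.mem_insert_iff, Set.mem_singleton_iff] at ht ⊢
  rcases ht with rfl | rfl | rfl | rfl | rfl | rfl <;> simp

theorem closure_S : Submonoid.closure S = ⊤ := by
  have hS : ∀ i : Fin 3, FreeGroup.of i ∈ S := by
    intro i
    fin_cases i <;> simp [S, a, b, c]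
  rw [eq_top_iff]
  intro u _
  induction u using FreeGroup.induction_on with
  | C1 => exact one_mem _
  | of i => exact Submonoid.subset_closure (hS i)
  | inv_of i _ => exact Submonoid.subset_closure (inv_mem_S (hS i))
  | mul u v hu hv => exact mul_mem (hu trivial) (hv trivial)

theorem abs_expSum_le (i : Fin 3) {m : ℕ} {g : F3} (hg : IsProdLE S m g) :
    |expSum i g| ≤ m := by
  obtain ⟨l, hl, hT, rfl⟩ := hg
  refine le_trans ?_ (Int.ofNat_le.2 hl)
  clear hl
  induction l with
  | nil => simp
  | cons t l ih =>
    have h1 := ih fun s hs => hT s (List.mem_cons_of_mem _ hs)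
    have h2 := abs_expSum_le_one i (hT t List.mem_cons_self)
    rw [List.prod_cons, expSum_mul]
    have := abs_add_le (expSum i t) (expSum i l.prod)
    push_cast [List.length_cons]
    omega

theorem x_mem_X {v : F3} {j : ℕ} (hj : 2 ≤ j) (hv : wordLength S v ≤ 5 ^ j) : x v j ∈ X :=
  Or.inl ⟨j, hj, v, hv, rfl⟩

/-! ### The words and their prefixes -/

/-- The block `a ^ (5 ^ (2n)) b ^ (5 ^ (2n)) c ^ k`. -/
def block (n k : ℕ) : F3 := a ^ 5 ^ (2 * n) * b ^ 5 ^ (2 * n) * c ^ k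

/-- The product of the first `i` blocks. -/
def blockProd (n k : ℕ → ℕ) : ℕ → F3
  | 0 => 1
  | i + 1 => blockProd n k i * block (n i) (k i)

/-- The prefix ending where the power of `b` in the `i`-th block begins. -/
def bStart (n k : ℕ → ℕ) (i : ℕ) : F3 := blockProd n k i * a ^ 5 ^ (2 * n i)

theorem bStart_succ (n k : ℕ → ℕ) (i : ℕ) :
    bStart n k (i + 1) =
      bStart n k i * b ^ 5 ^ (2 * n i) * c ^ k i * a ^ 5 ^ (2 * n (i + 1)) := by
  simp [bStart, blockProd, block, mul_assoc]

/-- The `a`-exponent sum is constant along a power of `b`, so it identifies the block to which a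
weighted edge belongs. -/
theorem expSum_a_bStart_strictMono (n k : ℕ → ℕ) : StrictMono fun i => expSum 0 (bStart n k i) := by
  refine strictMono_nat_of_lt_succ fun i => ?_
  simp [bStart_succ]

theorem expSum_c_bStart_mono (n k : ℕ → ℕ) : Monotone fun i => expSum 2 (bStart n k i) := by
  refine monotone_nat_of_le_succ fun i => ?_
  simp [bStart_succ]

/-- The power of `c` just before block `i` already exceeds `5 ^ (2 * n i)`; this separates block `i`
from all earlier ones. -/
theorem expSum_c_bStart_lt {n k : ℕ → ℕ} {r : ℕ}
    (hk : ∀ i, i + 1 < r → 5 ^ (2 * n (i + 1)) < k i) {i i' : ℕ} (hi : i < r) (h : i' < i) :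
    expSum 2 (bStart n k i') + 5 ^ (2 * n i) < expSum 2 (bStart n k i) := by
  obtain ⟨m, rfl⟩ : ∃ m, i = m + 1 := ⟨i - 1, by omega⟩
  have h1 := expSum_c_bStart_mono n k (Nat.lt_succ_iff.1 h)
  have h2 : ((5 ^ (2 * n (m + 1)) : ℕ) : ℤ) < k m := by exact_mod_cast hk m hi
  simp only [bStart_succ, expSum_mul, expSum_pow] at h1 ⊢
  push_cast at h2
  simp
  linarith

/-- `g` is the start of the `l`-th edge of the power of `b` in the
`i`-th block. -/
def IsOnB (n k : ℕ → ℕ) (r : ℕ) (g : F3) (i l : ℕ) : Prop :=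
  i < r ∧ l < 5 ^ (2 * n i) ∧ g = bStart n k i * b ^ l

theorem IsOnB.expSum_a {n k : ℕ → ℕ} {r i l : ℕ} {g : F3} (h : IsOnB n k r g i l) :
    expSum 0 g = expSum 0 (bStart n k i) := by
  simp [h.2.2]

theorem IsOnB.index_eq {n k : ℕ → ℕ} {r i l i' l' : ℕ} {g g' : F3} (h : IsOnB n k r g i l)
    (h' : IsOnB n k r g' i' l') (hg : expSum 0 g = expSum 0 g') : i = i' :=
  (expSum_a_bStart_strictMono n k).injective (by rw [← h.expSum_a, ← h'.expSum_a, hg])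

/-! ### Weights on the `b`-edges of the word -/

/-- The weight of an edge of the power of `b` in a block with parameter `n`. -/
def weight (n : ℕ) : ℚ := 6 / 5 + 1 / 5 ^ (2 * n)

theorem weight_nonneg (n : ℕ) : 0 ≤ weight n := by unfold weight; positivity

/-- The bound is below 2, so a letter `b`, which also lowers `-expSum 1` by 1, respects the
Lipschitz bound. -/
theorem weight_le {n : ℕ} (hn : 2 ≤ n) : weight n ≤ 6 / 5 + 1 / 625 := by
  have : (5 : ℚ) ^ 4 ≤ 5 ^ (2 * n) := pow_le_pow_right₀ (by norm_num) (by omega)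
  unfold weight
  gcongr
  linarith

theorem weight_mul (n : ℕ) : weight n * 5 ^ (2 * n) = 6 / 5 * 5 ^ (2 * n) + 1 := by
  unfold weight
  field_simp

open Classical in
/-- The weight of the edge from `g` to `g * b`. -/
noncomputable def edgeWeight (n k : ℕ → ℕ) (r : ℕ) (g : F3) : ℚ :=
  if h : ∃ i l, IsOnB n k r g i l then weight (n h.choose) else 0

/-- The chosen block in the definition is the only possible one, by `index_eq`. -/
theorem IsOnB.edgeWeight {n k : ℕ → ℕ} {r i l : ℕ} {g : F3} (h : IsOnB n k r g i l) :
    edgeWeight n k r g = weight (n i) := by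
  have hex : ∃ i l, IsOnB n k r g i l := ⟨i, l, h⟩
  obtain ⟨l', hl'⟩ := hex.choose_spec
  rw [WordLen.edgeWeight, dif_pos hex, hl'.index_eq h rfl]

theorem edgeWeight_eq_zero {n k : ℕ → ℕ} {r : ℕ} {g : F3} (h : ¬∃ i l, IsOnB n k r g i l) :
    edgeWeight n k r g = 0 := dif_neg h

theorem edgeWeight_nonneg (n k : ℕ → ℕ) (r : ℕ) (g : F3) : 0 ≤ edgeWeight n k r g := by
  by_cases h : ∃ i l, IsOnB n k r g i l
  · obtain ⟨i, l, h⟩ := h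
    exact h.edgeWeight ▸ weight_nonneg _
  · exact (edgeWeight_eq_zero h).ge

theorem edgeWeight_le {n : ℕ → ℕ} (hn : ∀ i, 2 ≤ n i) (k : ℕ → ℕ) (r : ℕ) (g : F3) :
    edgeWeight n k r g ≤ 6 / 5 + 1 / 625 := by
  by_cases h : ∃ i l, IsOnB n k r g i l
  · obtain ⟨i, l, h⟩ := h
    exact h.edgeWeight ▸ weight_le (hn i)
  · rw [edgeWeight_eq_zero h]; norm_num

/-- The edges on a path `y, y b, …, y b ^ J` have positive weight only in one block, whose
power of `b` bounds their number. -/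
theorem sum_edgeWeight_le {n k : ℕ → ℕ} {r i l₀ l₁ : ℕ} {y : F3}
    (h : IsOnB n k r (y * b ^ l₀) i l₁) (J : ℕ) :
    ∑ l ∈ range J, edgeWeight n k r (y * b ^ l) ≤ weight (n i) * J ∧
      ∑ l ∈ range J, edgeWeight n k r (y * b ^ l) ≤ weight (n i) * 5 ^ (2 * n i) := by
  classical
  have hi : ∀ l i' l', IsOnB n k r (y * b ^ l) i' l' → i' = i := fun l i' l' h' =>
    h'.index_eq h (by simp)
  have hle : ∀ l, edgeWeight n k r (y * b ^ l) ≤ weight (n i) := by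
    intro l
    by_cases hl : ∃ i l', IsOnB n k r (y * b ^ l) i l'
    · obtain ⟨i', l', hl⟩ := hl
      rw [hl.edgeWeight, hi l i' l' hl]
    · rw [edgeWeight_eq_zero hl]; exact weight_nonneg _
  constructor
  · refine (sum_le_card_nsmul _ _ _ fun l _ => hle l).trans ?_
    simp [mul_comm]
  · rw [← sum_filter_ne_zero]
    refine (sum_le_card_nsmul _ _ _ fun l _ => hle l).trans ?_
    rw [nsmul_eq_mul, mul_comm]
    refine mul_le_mul_of_nonneg_left ?_ (weight_nonneg _)
    have key : ∀ l : ℕ, edgeWeight n k r (y * b ^ l) ≠ 0 →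
        ∃ l' : ℕ, l' < 5 ^ (2 * n i) ∧ expSum 1 y + l = expSum 1 (bStart n k i) + l' := by
      intro l hl
      by_contra hcon
      refine hl (edgeWeight_eq_zero ?_)
      rintro ⟨i', l', hl'⟩
      obtain rfl := hi l i' l' hl'
      refine hcon ⟨l', hl'.2.1, ?_⟩
      have := congrArg (expSum 1) hl'.2.2
      simpa using this
    -- The `b`-exponent sum, measured from the start of the block, injects the weighted edges into
    -- the positions of its `b`-power.
    have hcard : #{l ∈ range J | edgeWeight n k r (y * b ^ l) ≠ 0} ≤ #(range (5 ^ (2 * n i))) := by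
      refine card_le_card_of_injOn
        (fun l => (expSum 1 y + l - expSum 1 (bStart n k i)).toNat) ?_ ?_
      · intro l hl
        obtain ⟨l', h1, h2⟩ := key l (mem_filter.1 hl).2
        simp only [coe_range, Set.mem_Iio]
        rw [h2]
        simpa using h1
      · intro l hl m hm hlm
        obtain ⟨l', -, h2⟩ := key l (mem_filter.1 hl).2
        obtain ⟨m', -, h3⟩ := key m (mem_filter.1 hm).2
        simp only at hlm
        omega
    rw [card_range] at hcard
    exact_mod_cast hcard

/-! ### The potential of the edge weights -/

/-- `P` changes only along edges labelled `b`, by the edge weight. -/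
structure IsPotential (n k : ℕ → ℕ) (r : ℕ) (P : F3 → ℚ) : Prop where
  map_one : P 1 = 0
  mul_a : ∀ g, P (g * a) = P g
  mul_b : ∀ g, P (g * b) = P g + edgeWeight n k r g
  mul_c : ∀ g, P (g * c) = P g

theorem exists_isPotential (n k : ℕ → ℕ) (r : ℕ) : ∃ P, IsPotential n k r P := by
  obtain ⟨P, h1, hP⟩ := exists_potential
    fun (g : F3) (i : Fin 3) => if i = 1 then edgeWeight n k r g else 0
  exact ⟨P, h1, fun g => by simpa [a] using hP g 0, fun g => by simpa [b] using hP g 1,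
    fun g => by simpa [c] using hP g 2⟩

namespace IsPotential

variable {n k : ℕ → ℕ} {r : ℕ} {P : F3 → ℚ}

theorem mul_a_inv (hP : IsPotential n k r P) (g : F3) : P (g * a⁻¹) = P g := by
  simpa using (hP.mul_a (g * a⁻¹)).symm

theorem mul_c_inv (hP : IsPotential n k r P) (g : F3) : P (g * c⁻¹) = P g := by
  simpa using (hP.mul_c (g * c⁻¹)).symm

theorem mul_b_inv (hP : IsPotential n k r P) (g : F3) :
    P (g * b⁻¹) = P g - edgeWeight n k r (g * b⁻¹) := by
  have := hP.mul_b (g * b⁻¹)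
  rw [inv_mul_cancel_right] at this
  linarith

theorem mul_a_pow (hP : IsPotential n k r P) (g : F3) (m : ℕ) : P (g * a ^ m) = P g := by
  induction m with
  | zero => simp
  | succ m ih => rw [pow_succ, ← mul_assoc, hP.mul_a, ih]

theorem mul_c_pow (hP : IsPotential n k r P) (g : F3) (m : ℕ) : P (g * c ^ m) = P g := by
  induction m with
  | zero => simp
  | succ m ih => rw [pow_succ, ← mul_assoc, hP.mul_c, ih]

theorem mul_b_pow (hP : IsPotential n k r P) (g : F3) (m : ℕ) :
    P (g * b ^ m) = P g + ∑ l ∈ range m, edgeWeight n k r (g * b ^ l) := by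
  induction m with
  | zero => simp
  | succ m ih => rw [pow_succ, ← mul_assoc, hP.mul_b, ih, sum_range_succ, add_assoc]

theorem mul_letter_le (hP : IsPotential n k r P) (hn : ∀ i, 2 ≤ n i) (g : F3) {t : F3}
    (ht : t ∈ S) : P (g * t) ≤ P g + (6 / 5 + 1 / 625) := by
  have h1 := edgeWeight_le hn k r g
  have h2 := edgeWeight_nonneg n k r (g * b⁻¹)
  simp only [S, Set.mem_insert_iff, Set.mem_singleton_iff] at ht
  rcases ht with rfl | rfl | rfl | rfl | rfl | rfl
  · rw [hP.mul_a]; norm_num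
  · rw [hP.mul_b]; linarith
  · rw [hP.mul_c]; norm_num
  · rw [hP.mul_a_inv]; norm_num
  · rw [hP.mul_b_inv]; linarith
  · rw [hP.mul_c_inv]; norm_num

theorem blockProd_eq (hP : IsPotential n k r P) {m : ℕ} (hm : m ≤ r) :
    P (blockProd n k m) = ∑ i ∈ range m, (6 / 5 * 5 ^ (2 * n i) + 1) := by
  induction m with
  | zero => simpa [blockProd] using hP.map_one
  | succ m ih =>
    have hb : ∀ l ∈ range (5 ^ (2 * n m)),
        edgeWeight n k r (blockProd n k m * a ^ 5 ^ (2 * n m) * b ^ l) = weight (n m) :=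
      fun l hl => IsOnB.edgeWeight ⟨hm, mem_range.1 hl, rfl⟩
    rw [blockProd, block, ← mul_assoc, ← mul_assoc, hP.mul_c_pow, hP.mul_b_pow, hP.mul_a_pow,
      sum_congr rfl hb, ih (by omega), sum_range_succ, ← weight_mul]
    simp [mul_comm]

/-- The potential is constant on a ball at distance `5 ^ (2j)` from the powers of `b`. -/
theorem mul_eq_of_isProdLE (hP : IsPotential n k r P)
    (hk : ∀ i, i + 1 < r → 5 ^ (2 * n (i + 1)) < k i) {i l₀ l₁ j R : ℕ} {q u : F3}
    (h : IsOnB n k r (q * a ^ 5 ^ (2 * j) * b ^ l₀) i l₁) (hj : j ≤ n i) (hR : R < 5 ^ (2 * j))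
    (hu : IsProdLE S R u) : P (q * u) = P q := by
  have hfar : ∀ u, IsProdLE S R u → edgeWeight n k r (q * u) = 0 := by
    intro u hu
    refine edgeWeight_eq_zero ?_
    rintro ⟨i', l', h'⟩
    have hRZ : (R : ℤ) < 5 ^ (2 * j) := by exact_mod_cast hR
    have hJ : (5 : ℤ) ^ (2 * j) ≤ 5 ^ (2 * n i) := pow_le_pow_right₀ (by norm_num) (by omega)
    -- Earlier blocks are out of reach by `c`-exponent sum. Block `i` and later ones are out of
    -- reach by `a`-exponent sum, since `q` lies `5 ^ (2 * j)` letters `a` before block `i`.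
    rcases lt_or_ge i' i with hlt | hge
    · have h1 := expSum_c_bStart_lt hk h.1 hlt
      have h2 := abs_le.1 (abs_expSum_le 2 hu)
      have h3 := congrArg (expSum 2) h.2.2
      have h4 := congrArg (expSum 2) h'.2.2
      simp at h3 h4
      linarith
    · have h1 := (expSum_a_bStart_strictMono n k).monotone hge
      have h2 := abs_le.1 (abs_expSum_le 0 hu)
      have h3 := congrArg (expSum 0) h.2.2
      have h4 := congrArg (expSum 0) h'.2.2
      simp at h1 h3 h4
      linarith
  refine hu.apply_mul_eq fun u t ht hu hut => ?_
  rw [← mul_assoc] at *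
  simp only [S, Set.mem_insert_iff, Set.mem_singleton_iff] at ht
  rcases ht with rfl | rfl | rfl | rfl | rfl | rfl
  · rw [hP.mul_a]
  · rw [hP.mul_b, hfar u hu, add_zero]
  · rw [hP.mul_c]
  · rw [hP.mul_a_inv]
  · rw [hP.mul_b_inv, mul_assoc, hfar _ hut, sub_zero]
  · rw [hP.mul_c_inv]

/-- The bound equals `weight j * 5 ^ (2 * j)`, attained when the final `b`-power runs along a whole
block with parameter `j`; this dictates the form of `weight`. -/
theorem mul_x_le (hP : IsPotential n k r P) (hn : ∀ i, 2 ≤ n i)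
    (hk : ∀ i, i + 1 < r → 5 ^ (2 * n (i + 1)) < k i) {j : ℕ} (hj : 2 ≤ j) {v : F3}
    (hv : wordLength S v ≤ 5 ^ j) (p : F3) :
    P (p * x v j) ≤ P p + (1 + 5 ^ (2 * j - 1) + 5 ^ (2 * j)) := by
  have hvS : IsProdLE S (5 ^ j) v := (isProdLE_wordLength closure_S v).mono hv
  have hbS : b ∈ S := by simp [S]
  have huS : IsProdLE S (5 ^ j + 5 ^ (2 * j - 1) + 5 ^ j) (v * b ^ 5 ^ (2 * j - 1) * v⁻¹) :=
    (hvS.mul (.pow_of_mem hbS _)).mul (hvS.inv fun _ => inv_mem_S)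
  set u := v * b ^ 5 ^ (2 * j - 1) * v⁻¹ with hu
  have hx : p * x v j = p * u * a ^ 5 ^ (2 * j) * b ^ 5 ^ (2 * j) := by simp [x, hu, mul_assoc]
  have hM : 5 * 5 ^ (2 * j - 1) = 5 ^ (2 * j) := by
    rw [← pow_succ']; congr 1; omega
  -- Since `j ≥ 2`, the conjugate `u` has length at most `(2/25 + 1/5) * 5 ^ (2 * j)`, so it raises
  -- `P` by less than `0.34 * 5 ^ (2 * j)`.
  have he : 25 * 5 ^ j ≤ 5 ^ (2 * j) := by
    rw [two_mul, pow_add]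
    exact Nat.mul_le_mul_right _ (Nat.pow_le_pow_right (n := 5) (by norm_num) hj)
  have he0 : 0 < 5 ^ j := by positivity
  have hMQ : (5 : ℚ) * 5 ^ (2 * j - 1) = 5 ^ (2 * j) := by exact_mod_cast hM
  have heQ : (25 : ℚ) * 5 ^ j ≤ 5 ^ (2 * j) := by exact_mod_cast he
  have he0Q : (0 : ℚ) < 5 ^ j := by positivity
  have hdrift : P (p * u) ≤
      P p + (6 / 5 + 1 / 625) * ((5 ^ j + 5 ^ (2 * j - 1) + 5 ^ j : ℕ) : ℚ) :=
    huS.apply_mul_le (by norm_num) (fun g t ht => hP.mul_letter_le hn g ht) p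
  push_cast at hdrift
  rw [hx, hP.mul_b_pow, hP.mul_a_pow]
  by_cases hex : ∃ l i l', IsOnB n k r (p * u * a ^ 5 ^ (2 * j) * b ^ l) i l'
  · obtain ⟨l, i, l', h⟩ := hex
    obtain ⟨hs1, hs2⟩ := sum_edgeWeight_le h (5 ^ (2 * j))
    rcases le_or_gt j (n i) with hji | hji
    -- Going back from `p * u` along `u⁻¹` shows that `u` contributes nothing; the weight decreases
    -- in `n`, which bounds the rest.
    · have hconst : P (p * u * u⁻¹) = P (p * u) :=
        hP.mul_eq_of_isProdLE hk h hji (by omega) (huS.inv fun _ => inv_mem_S)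
      rw [mul_inv_cancel_right] at hconst
      have hw : weight (n i) ≤ weight j := by
        unfold weight
        gcongr
        norm_num
      have hw' := mul_le_mul_of_nonneg_right hw (by positivity : (0 : ℚ) ≤ 5 ^ (2 * j))
      rw [weight_mul] at hw'
      push_cast at hs1
      linarith
    -- The whole block is worth at most `6/125 * 5 ^ (2 * j) + 1`, which leaves ample room for the
    -- drift along `u`.
    · have hN : (25 : ℚ) * 5 ^ (2 * n i) ≤ 5 ^ (2 * j) := by
        have : (5 : ℚ) ^ (2 * n i + 2) ≤ 5 ^ (2 * j) :=
          pow_le_pow_right₀ (by norm_num) (by omega)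
        rw [pow_add] at this
        linarith
      rw [weight_mul] at hs2
      linarith
  · rw [sum_eq_zero fun l _ => edgeWeight_eq_zero fun ⟨i, l', h⟩ => hex ⟨l, i, l', h⟩]
    linarith

/-- Corrected by exponent sums, the potential is 1-Lipschitz for `X`. -/
theorem lipschitz (hP : IsPotential n k r P) (hn : ∀ i, 2 ≤ n i)
    (hk : ∀ i, i + 1 < r → 5 ^ (2 * n (i + 1)) < k i) (g t : F3) (ht : t ∈ X) :
    P (g * t) + expSum 2 (g * t) - expSum 1 (g * t) ≤ P g + expSum 2 g - expSum 1 g + 1 := by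
  have h1 := edgeWeight_le hn k r g
  have h2 := edgeWeight_nonneg n k r (g * b⁻¹)
  rcases ht with ⟨j, hj, v, hv, rfl⟩ | ht
  · have h := hP.mul_x_le hn hk hj hv g
    simp [x] at h ⊢
    linarith
  · simp only [S, Set.mem_insert_iff, Set.mem_singleton_iff] at ht
    rcases ht with rfl | rfl | rfl | rfl | rfl | rfl
    · rw [hP.mul_a]; simp
    · rw [hP.mul_b]; simp; linarith
    · rw [hP.mul_c]; simp; linarith
    · rw [hP.mul_a_inv]; simp
    · rw [hP.mul_b_inv]; simp; linarith
    · rw [hP.mul_c_inv]; simp; linarith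

end IsPotential

/-! ### The length of the words -/

theorem isProdLE_block {n : ℕ} (hn : 2 ≤ n) (k : ℕ) :
    IsProdLE X (k + (5 ^ (2 * n - 1) + 1)) (block n k) := by
  have hx : x 1 n ∈ X := x_mem_X hn ((wordLength_le IsProdLE.one).trans (Nat.zero_le _))
  have hb : b⁻¹ ∈ X := Or.inr (by simp [S])
  have hc : c ∈ X := Or.inr (by simp [S])
  have h := ((IsProdLE.pow_of_mem hb (5 ^ (2 * n - 1))).mul (.of_mem hx)).mul (.pow_of_mem hc k)
  have he : b⁻¹ ^ 5 ^ (2 * n - 1) * x 1 n * c ^ k = block n k := by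
    simp [x, block, ← mul_assoc]
  rw [he] at h
  exact h.mono (by omega)

theorem isProdLE_blockProd {n : ℕ → ℕ} (hn : ∀ i, 2 ≤ n i) (k : ℕ → ℕ) (r : ℕ) :
    IsProdLE X (∑ i ∈ range r, (k i + (5 ^ (2 * n i - 1) + 1))) (blockProd n k r) := by
  induction r with
  | zero => simpa [blockProd] using IsProdLE.one
  | succ r ih =>
    rw [sum_range_succ, blockProd]
    exact ih.mul (isProdLE_block (hn r) (k r))

theorem expSum_b_blockProd (n k : ℕ → ℕ) (r : ℕ) :
    expSum 1 (blockProd n k r) = ∑ i ∈ range r, 5 ^ (2 * n i) := by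
  induction r with
  | zero => simp [blockProd]
  | succ r ih => simp [blockProd, block, sum_range_succ, ih]

theorem expSum_c_blockProd (n k : ℕ → ℕ) (r : ℕ) :
    expSum 2 (blockProd n k r) = ∑ i ∈ range r, (k i : ℤ) := by
  induction r with
  | zero => simp [blockProd]
  | succ r ih => simp [blockProd, block, sum_range_succ, ih]

theorem wordLength_blockProd {n k : ℕ → ℕ} {r : ℕ} (hn : ∀ i, 2 ≤ n i)
    (hk : ∀ i, i + 1 < r → 5 ^ (2 * n (i + 1)) < k i) :
    wordLength X (blockProd n k r) = ∑ i ∈ range r, (k i + (5 ^ (2 * n i - 1) + 1)) := by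
  refine le_antisymm (wordLength_le (isProdLE_blockProd hn k r)) ?_
  obtain ⟨P, hP⟩ := exists_isPotential n k r
  have h := le_wordLength closure_X (F := fun g => P g + expSum 2 g - expSum 1 g)
    (by simp [hP.map_one]) (hP.lipschitz hn hk) (blockProd n k r)
  rw [hP.blockProd_eq le_rfl, expSum_b_blockProd, expSum_c_blockProd] at h
  push_cast at h
  rw [← sum_add_distrib, ← sum_sub_distrib] at h
  -- Per block: `6/5 * 5 ^ (2n) - 5 ^ (2n) = 5 ^ (2n-1)`.
  have hs : ∑ i ∈ range r, ((6 / 5 * 5 ^ (2 * n i) + 1) + (k i : ℚ) - 5 ^ (2 * n i)) =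
      ((∑ i ∈ range r, (k i + (5 ^ (2 * n i - 1) + 1)) : ℕ) : ℚ) := by
    push_cast
    refine sum_congr rfl fun i _ => ?_
    have hM : (5 : ℚ) * 5 ^ (2 * n i - 1) = 5 ^ (2 * n i) := by
      rw [← pow_succ']; congr 1; have := hn i; omega
    linarith
  rw [hs] at h
  exact_mod_cast h

theorem wordLength_block {n : ℕ} (hn : 2 ≤ n) (k : ℕ) :
    wordLength X (block n k) = k + (5 ^ (2 * n - 1) + 1) := by
  have h := wordLength_blockProd (n := fun _ => n) (k := fun _ => k) (r := 1) (fun _ => hn)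
    (fun i hi => by omega)
  simpa [blockProd] using h

theorem wordLength_c_pow (k : ℕ) : wordLength X (c ^ k) = k := by
  have hc : c ∈ X := Or.inr (by simp [S])
  refine le_antisymm (wordLength_le (.pow_of_mem hc k)) ?_
  have hF : ∀ g, ∀ t ∈ X, (expSum 2 (g * t) : ℚ) ≤ expSum 2 g + 1 := by
    rintro g t (⟨j, -, v, -, rfl⟩ | ht)
    · simp [x]
    · have : expSum 2 t ≤ 1 := (abs_le.1 (abs_expSum_le_one 2 ht)).2
      have h' : (expSum 2 t : ℚ) ≤ 1 := by exact_mod_cast this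
      simpa using h'
  have h := le_wordLength closure_X (F := fun g => (expSum 2 g : ℚ)) (by simp) hF (c ^ k)
  simpa using h

theorem prod_ofFn_block (n k : ℕ → ℕ) (r : ℕ) :
    (List.ofFn fun i : Fin r => block (n i) (k i)).prod = blockProd n k r := by
  induction r with
  | zero => simp [blockProd]
  | succ r ih => rw [List.ofFn_succ']; simp [blockProd, ih]

end WordLen

/-! ### The proposition for finite families -/

theorem proposition3p8 (r : ℕ) (n k : Fin r → ℕ) (hn : ∀ i, 2 ≤ n i)
    (hk : ∀ i j : Fin r, (i : ℕ) + 1 = (j : ℕ) → 3 * 5 ^ (2 * n j) < k i) :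
    WordLen.wordLength WordLen.X
        (List.ofFn fun i : Fin r =>
          WordLen.a ^ 5 ^ (2 * n i) * WordLen.b ^ 5 ^ (2 * n i) * WordLen.c ^ k i).prod
      = ∑ i, k i + ∑ i, (5 ^ (2 * n i - 1) + 1) ∧
    WordLen.wordLength WordLen.X
        (List.ofFn fun i : Fin r =>
          WordLen.a ^ 5 ^ (2 * n i) * WordLen.b ^ 5 ^ (2 * n i) * WordLen.c ^ k i).prod
      = ∑ i, WordLen.wordLength WordLen.X
          (WordLen.a ^ 5 ^ (2 * n i) * WordLen.b ^ 5 ^ (2 * n i) * WordLen.c ^ k i) ∧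
    WordLen.wordLength WordLen.X
        (List.ofFn fun i : Fin r =>
          WordLen.a ^ 5 ^ (2 * n i) * WordLen.b ^ 5 ^ (2 * n i) * WordLen.c ^ k i).prod
      = ∑ i, WordLen.wordLength WordLen.X
          (WordLen.a ^ 5 ^ (2 * n i) * WordLen.b ^ 5 ^ (2 * n i))
        + ∑ i, WordLen.wordLength WordLen.X (WordLen.c ^ k i) := by
  -- The default `2` keeps `2 ≤ n' i` true for all `i`; values beyond `r` do not affect the product.
  let n' : ℕ → ℕ := fun i => if h : i < r then n ⟨i, h⟩ else 2
  let k' : ℕ → ℕ := fun i => if h : i < r then k ⟨i, h⟩ else 0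
  have hn_eq : ∀ i : Fin r, n' i = n i := fun i => by simp [n']
  have hk_eq : ∀ i : Fin r, k' i = k i := fun i => by simp [k']
  have hn' : ∀ i, 2 ≤ n' i := by
    intro i
    by_cases h : i < r
    · simpa [n', h] using hn ⟨i, h⟩
    · simp [n', h]
  have hk' : ∀ i, i + 1 < r → 5 ^ (2 * n' (i + 1)) < k' i := by
    intro i hi
    have h := hk ⟨i, by omega⟩ ⟨i + 1, hi⟩ rfl
    rw [← hn_eq, ← hk_eq] at h
    simp only at h
    omega
  have hprod : (List.ofFn fun i : Fin r => WordLen.block (n i) (k i)).prod =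
      WordLen.blockProd n' k' r := by
    rw [← WordLen.prod_ofFn_block]
    simp only [hn_eq, hk_eq]
  have hmain : WordLen.wordLength WordLen.X
      (List.ofFn fun i : Fin r => WordLen.block (n i) (k i)).prod =
      ∑ i, k i + ∑ i, (5 ^ (2 * n i - 1) + 1) := by
    rw [hprod, WordLen.wordLength_blockProd hn' hk', ← Finset.sum_add_distrib,
      ← Fin.sum_univ_eq_sum_range (fun i => k' i + (5 ^ (2 * n' i - 1) + 1))]
    simp only [hn_eq, hk_eq]
  have hab : ∀ m : ℕ, 2 ≤ m → WordLen.wordLength WordLen.X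
      (WordLen.a ^ 5 ^ (2 * m) * WordLen.b ^ 5 ^ (2 * m)) = 5 ^ (2 * m - 1) + 1 := by
    intro m hm
    simpa [WordLen.block] using WordLen.wordLength_block hm 0
  refine ⟨hmain, hmain.trans ?_, hmain.trans ?_⟩
  · rw [← Finset.sum_add_distrib]
    exact Finset.sum_congr rfl fun i _ => (WordLen.wordLength_block (hn i) (k i)).symm
  · rw [add_comm]
    congr 1
    · exact Finset.sum_congr rfl fun i _ => (hab (n i) (hn i)).symm
    · exact Finset.sum_congr rfl fun i _ => (WordLen.wordLength_c_pow (k i)).symm
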